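/- A dcpo is a (possibly empty) poset in which every nonempty directed subset has a supremum; $\mathbf{DCPO}$ is the category of dcpos and Scott-continuous maps. A d-space is a $T_0$ space whose specialization order ($x\le y$ iff $x\in\overline{\{y\}}$) is a dcpo and whose open sets are all Scott open in this order; $\mathbf D$ is the category of d-spaces and continuous maps. Let $\Sigma\colon\mathbf{DCPO}\to\mathbf D$ equip a dcpo with its Scott topology and let $\Omega\colon\mathbf D\to\mathbf{DCPO}$ equip a d-space with its specialization order; then $\Sigma\dashv\Omega$, with transposition leaving the underlying functions unchanged. A $\mathtt K$-category $\mathbf K$ is a full subcategory of the category of $T_0$ spaces (its objects are called k-spaces) such that: (1) homeomorphic copies of k-spaces are k-spaces; (2) all sober spaces are k-spaces; (3) in a sober space, the intersection of any family of k-subspaces is a k-space in the relative topology; (4) if $f\colon S\to T$ is a continuous map of sober spaces and $A\subseteq T$ is a k-subspace, then $f^{-1}(A)$ is a k-subspace of $S$. For a space $X$ let $\mathcal V_wX$ be the set of subprobability valuations on $X$ (strict, modular, Scott-continuous maps $\nu\colon\mathcal OX\to[0,1]$) with the weak topology, generated by the sets $\{\nu\mid\nu(U)>r\}$ with $U$ open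 and $r\in[0,1]$. A valuation is simple if it is a finite (possibly empty) sum $\sum_i r_i\delta_{x_i}$ with $r_i>0$, $\sum_i r_i\le 1$, where $\delta_x$ is the Dirac valuation at $x$. Let $\mathcal V_{\mathbf K}X$ be the intersection of all k-subspaces of $\mathcal V_wX$ that contain all simple valuations, with the relative topology; for continuous $h\colon X\to Y$ let $\mathcal V_{\mathbf K}(h)(\nu)=\nu\circ h^{-1}$. For $g\colon X\to[0,1]$ continuous with respect to the Scott topology on $[0,1]$, put $\int g\,d\nu=\int_0^1\nu(g^{-1}((t,1]))\,dt$. **Theorem.** Let $\mathbf K$ be a $\mathtt K$-category all of whose objects are d-spaces. Then the endofunctor $\mathcal V_{\mathbf K}$ of $\mathbf D$ carries a monad structure with unit $x\mapsto\delta_x$ and with Kleisli extension, for continuous $f\colon X\to\mathcal V_{\mathbf K}Y$, $$f^\dagger(\nu)(U)=\int_{x\in X}f(x)(U)\,d\nu\qquad(U\subseteq Y\text{ open}),$$ and $\mathcal V_{\mathbf K,\le}:=\Omega\circ\mathcal V_{\mathbf K}\circ\Sigma$ is a monad on $\mathbf{DCPO}$: it is the monad induced by the composite of the adjunction $\Sigma\dashv\Omega$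 with the Eilenberg–Moore adjunction of the monad $\mathcal V_{\mathbf K}$ on $\mathbf D$. Its unit at a dcpo $D$ is $x\mapsto\delta_x$, and its Kleisli extension of a Scott-continuous map $f\colon D\to\mathcal V_{\mathbf K,\le}E$ is $f^\dagger(\nu)(U)=\int_{x\in D}f(x)(U)\,d\nu$ for $U\subseteq E$ Scott open. -/

import Mathlib

open CategoryTheory TopologicalSpace Topology

universe u

/-! ### Dcpos and Scott-continuous maps -/

/-- A dcpo: a poset (possibly empty) in which every nonempty directed subset has a supremum. -/
structure DCPO : Type (u + 1) where
  carrier : Type u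
  [order : PartialOrder carrier]
  directedComplete : ∀ d : Set carrier, d.Nonempty → DirectedOn (· ≤ ·) d → ∃ a, IsLUB d a

namespace DCPO

instance : CoeSort DCPO.{u} (Type u) := ⟨carrier⟩

attribute [instance] order

/-- Morphisms of dcpos are the Scott-continuous maps. -/
@[ext]
structure Hom (D E : DCPO.{u}) where
  toFun : D → E
  scottContinuous : ScottContinuous toFun

instance : Category DCPO.{u} where
  Hom := Hom
  id _ := ⟨id, ScottContinuous.id⟩
  comp f g := ⟨g.toFun ∘ f.toFun, f.scottContinuous.comp g.scottContinuous⟩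

end DCPO

/-! ### Sober spaces, d-spaces, K-categories -/

/-- Sober spaces: `T₀`, and every irreducible closed set is the closure of a point. -/
def IsSober (X : Type u) [TopologicalSpace X] : Prop := T0Space X ∧ QuasiSober X

/-- A d-space (monotone convergence space): a `T₀` space whose specialization order
(`x ≤ y` iff `x ∈ closure {y}`, the order of `Specialization X`) is directed complete, and all of
whose open sets are Scott open for that order. -/
def IsDSpace : ObjectProperty TopCat.{u} := fun X =>
  T0Space X ∧
  (∀ d : Set (Specialization X), d.Nonempty → DirectedOn (· ≤ ·) d → ∃ a, IsLUB d a) ∧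
  ∀ U : Set X, IsOpen U → IsOpen[Topology.scott (Specialization X) Set.univ] U

/-- The category of d-spaces and continuous maps. -/
abbrev DSpace : Type (u + 1) := (IsDSpace.{u}).FullSubcategory

/-- A K-category, given as a property of topological spaces (the property of being a k-space):
it determines a full subcategory of the category of `T₀` spaces. -/
structure IsKCategory (K : ObjectProperty TopCat.{u}) : Prop where
  t0 : ∀ X : TopCat.{u}, K X → T0Space X
  homeo : ∀ X Y : TopCat.{u}, Nonempty (X ≃ₜ Y) → K X → K Y
  sober : ∀ X : TopCat.{u}, IsSober X → K X
  sInter : ∀ S : TopCat.{u}, IsSober S → ∀ F : Set (Set S),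
    (∀ A ∈ F, K (TopCat.of A)) → K (TopCat.of (⋂₀ F : Set S))
  preimage : ∀ S T : TopCat.{u}, IsSober S → IsSober T → ∀ f : C(S, T), ∀ A : Set T,
    K (TopCat.of A) → K (TopCat.of (f ⁻¹' A))

/-! ### Subprobability valuations and the weak topology -/

/-- A subprobability valuation: a strict, modular, Scott-continuous map from the open sets
to `[0,1]`. -/
@[ext]
structure SubprobVal (X : Type u) [TopologicalSpace X] where
  toFun : Opens X → unitInterval
  scottContinuous : ScottContinuous toFun
  strict : toFun ⊥ = 0
  modular : ∀ U V, (toFun U : ℝ) + toFun V = toFun (U ⊔ V) + toFun (U ⊓ V)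

namespace SubprobVal

variable {X Y : Type u} [TopologicalSpace X] [TopologicalSpace Y]

instance : CoeFun (SubprobVal X) (fun _ => Opens X → unitInterval) := ⟨toFun⟩

/-- The weak topology, with subbasic open sets `[U > r]`. -/
instance : TopologicalSpace (SubprobVal X) :=
  generateFrom {s | ∃ (U : Opens X) (r : unitInterval), s = {ν : SubprobVal X | r < ν U}}

lemma scottContinuous_of {φ : Opens X → unitInterval} (hm : Monotone φ)
    (h : ∀ d : Set (Opens X), d.Nonempty → DirectedOn (· ≤ ·) d → ∀ r, r < φ (sSup d) →
      ∃ V ∈ d, r < φ V) : ScottContinuous φ := by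
  intro d hd hdir a ha
  obtain rfl : a = sSup d := ha.unique (isLUB_sSup d)
  refine ⟨hm.mem_upperBounds_image ha.1, fun b hb => ?_⟩
  by_contra hlt
  obtain ⟨V, hV, hlt'⟩ := h d hd hdir b (not_le.1 hlt)
  exact absurd (hb ⟨V, hV, rfl⟩) (not_le.2 hlt')

lemma exists_lt (ν : SubprobVal X) {d : Set (Opens X)} (hd : d.Nonempty)
    (hdir : DirectedOn (· ≤ ·) d) {r : unitInterval} (hr : r < ν (sSup d)) :
    ∃ V ∈ d, r < ν V := by
  obtain ⟨_, ⟨V, hV, rfl⟩, h⟩ :=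
    (lt_isLUB_iff (ν.scottContinuous hd hdir (isLUB_sSup d))).1 hr
  exact ⟨V, hV, h⟩

open Classical in
/-- The Dirac valuation at a point. -/
noncomputable def dirac (x : X) : SubprobVal X where
  toFun U := if x ∈ U then 1 else 0
  scottContinuous := by
    refine scottContinuous_of (fun U V h => ?_) fun d hd hdir r hr => ?_
    · by_cases hx : x ∈ U
      · simp [hx, h hx]
      · simp [hx]
    · by_cases hx : x ∈ sSup d
      · obtain ⟨V, hV, hxV⟩ := Opens.mem_sSup.1 hx
        exact ⟨V, hV, by simpa [hx, hxV] using hr⟩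
      · simp [hx] at hr
  strict := by simp
  modular U V := by
    by_cases h : x ∈ U <;> by_cases h' : x ∈ V <;> simp [h, h', Opens.mem_sup, Opens.mem_inf]

/-- Simple valuations: finite (possibly empty) sums `∑ rᵢ δ_{xᵢ}` with `rᵢ > 0`, `∑ rᵢ ≤ 1`. -/
def IsSimple (ν : SubprobVal X) : Prop :=
  ∃ (n : ℕ) (r : Fin n → ℝ) (x : Fin n → X), (∀ i, 0 < r i) ∧ ∑ i, r i ≤ 1 ∧
    ∀ U, (ν U : ℝ) = ∑ i, r i * (dirac (x i) U : ℝ)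

/-- The image valuation `U ↦ ν (f⁻¹ U)`. -/
def map (f : C(X, Y)) (ν : SubprobVal X) : SubprobVal Y where
  toFun U := ν (Opens.comap f U)
  scottContinuous := by
    refine ScottContinuous.comp (g := ν.toFun) (f := Opens.comap f) ?_ ν.scottContinuous
    intro d _ _ a ha
    obtain rfl : a = sSup d := ha.unique (isLUB_sSup d)
    rw [map_sSup]
    exact isLUB_sSup _
  strict := by rw [map_bot]; exact ν.strict
  modular U V := by rw [map_sup, map_inf]; exact ν.modular _ _

lemma isSimple_dirac (x : X) : (dirac x).IsSimple :=
  ⟨1, fun _ => 1, fun _ => x, by simp, by simp, by simp⟩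

lemma map_dirac (f : C(X, Y)) (x : X) : map f (dirac x) = dirac (f x) := rfl

lemma IsSimple.map {ν : SubprobVal X} (h : ν.IsSimple) (f : C(X, Y)) :
    (SubprobVal.map f ν).IsSimple := by
  obtain ⟨n, r, x, h0, h1, h2⟩ := h
  exact ⟨n, r, f ∘ x, h0, h1, fun U => h2 (Opens.comap f U)⟩

lemma isOpen_gt (U : Opens X) (r : unitInterval) : IsOpen {ν : SubprobVal X | r < ν U} :=
  isOpen_generateFrom_of_mem ⟨U, r, rfl⟩

lemma continuous_map (f : C(X, Y)) : Continuous (map f) := by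
  refine continuous_generateFrom_iff.2 ?_
  rintro _ ⟨U, r, rfl⟩
  exact isOpen_gt (Opens.comap f U) r

/-- The specialization order of the weak topology is the stochastic order. -/
lemma specializes_iff {μ ν : SubprobVal X} : ν ⤳ μ ↔ ∀ U, μ U ≤ ν U := by
  constructor
  · intro h U
    by_contra hlt
    exact lt_irrefl (ν U) (h.mem_open (isOpen_gt U (ν U)) (not_le.1 hlt))
  · intro h
    rw [Specializes, nhds_generateFrom, nhds_generateFrom]
    refine le_iInf₂ fun s hs => iInf₂_le s ⟨?_, hs.2⟩
    obtain ⟨U, r, rfl⟩ := hs.2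
    exact lt_of_lt_of_le hs.1 (h U)

/-- The space of subprobability valuations with the weak topology is sober. -/
theorem isSober : IsSober (SubprobVal X) := by
  refine ⟨⟨fun μ ν h => ?_⟩, ⟨fun {C} hC hcl => ?_⟩⟩
  · ext U
    exact congrArg _ (le_antisymm (specializes_iff.1 h.specializes' U)
      (specializes_iff.1 h.specializes U))
  · have hlub : ∀ U : Opens X, ∃ a : unitInterval, IsLUB ((fun μ : SubprobVal X => μ U) '' C) a :=
      fun U => ⟨_, isLUB_sSup _⟩
    choose φ hφ using hlub
    have hle : ∀ μ ∈ C, ∀ U, μ U ≤ φ U := fun μ hμ U => (hφ U).1 ⟨μ, hμ, rfl⟩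
    have hex : ∀ U r, r < φ U → ∃ μ ∈ C, r < μ U := by
      intro U r h
      obtain ⟨_, ⟨μ, hμ, rfl⟩, h⟩ := (lt_isLUB_iff (hφ U)).1 h
      exact ⟨μ, hμ, h⟩
    have hex2 : ∀ U r V s, r < φ U → s < φ V → ∃ μ ∈ C, r < μ U ∧ s < μ V := by
      intro U r V s h h'
      obtain ⟨μ, hμ, h⟩ := hex U r h
      obtain ⟨μ', hμ', h'⟩ := hex V s h'
      obtain ⟨ξ, hξ, h1, h2⟩ :=
        hC.2 _ _ (isOpen_gt U r) (isOpen_gt V s) ⟨μ, hμ, h⟩ ⟨μ', hμ', h'⟩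
      exact ⟨ξ, hξ, h1, h2⟩
    have hmono : Monotone φ := fun U V h => (hφ U).2 (by
      rintro _ ⟨μ, hμ, rfl⟩
      exact (μ.scottContinuous.monotone h).trans (hle μ hμ V))
    have hmod : ∀ U V U' V' : Opens X,
        (∀ μ : SubprobVal X, (μ U : ℝ) + μ V ≤ μ U' + μ V') →
        (φ U : ℝ) + φ V ≤ φ U' + φ V' := by
      intro U V U' V' h
      by_contra hlt
      push Not at hlt
      obtain ⟨ε, hε, hε'⟩ : ∃ ε : ℝ, 0 < ε ∧ (φ U' : ℝ) + φ V' + 2 * ε < φ U + φ V :=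
        ⟨((φ U : ℝ) + φ V - (φ U' + φ V')) / 4, by linarith, by linarith⟩
      have key : ∀ W : Opens X, ∃ O : Set (SubprobVal X), IsOpen O ∧ (C ∩ O).Nonempty ∧
          ∀ μ ∈ O, (φ W : ℝ) - ε < μ W := by
        intro W
        by_cases hW : (φ W : ℝ) - ε < 0
        · exact ⟨Set.univ, isOpen_univ, by simpa using hC.1,
            fun μ _ => hW.trans_le (μ W).2.1⟩
        · have hmem : (φ W : ℝ) - ε ∈ unitInterval :=
            ⟨not_lt.1 hW, by have := (φ W).2.2; linarith⟩
          obtain ⟨μ, hμ, h⟩ := hex W ⟨(φ W : ℝ) - ε, hmem⟩ (by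
            change (φ W : ℝ) - ε < φ W; linarith)
          exact ⟨_, isOpen_gt W ⟨(φ W : ℝ) - ε, hmem⟩, ⟨μ, hμ, h⟩, fun μ hμ => hμ⟩
      obtain ⟨O₁, ho₁, hn₁, h₁⟩ := key U
      obtain ⟨O₂, ho₂, hn₂, h₂⟩ := key V
      obtain ⟨ξ, hξ, hx₁, hx₂⟩ := hC.2 _ _ ho₁ ho₂ hn₁ hn₂
      have e₁ := h₁ ξ hx₁
      have e₂ := h₂ ξ hx₂
      have e₃ : (ξ U' : ℝ) ≤ φ U' := hle ξ hξ U'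
      have e₄ : (ξ V' : ℝ) ≤ φ V' := hle ξ hξ V'
      have e₅ := h ξ
      linarith
    let ν : SubprobVal X :=
      { toFun := φ
        scottContinuous := by
          refine scottContinuous_of hmono fun d hd hdir r hr => ?_
          obtain ⟨μ, hμ, h⟩ := hex _ r hr
          obtain ⟨V, hV, h⟩ := μ.exists_lt hd hdir h
          exact ⟨V, hV, h.trans_le (hle μ hμ V)⟩
        strict := le_antisymm ((hφ ⊥).2 (by
          rintro _ ⟨μ, _, rfl⟩
          exact μ.strict.le)) (φ ⊥).2.1
        modular := fun U V => le_antisymm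
          (hmod U V (U ⊔ V) (U ⊓ V) fun μ => (μ.modular U V).le)
          (hmod (U ⊔ V) (U ⊓ V) U V fun μ => (μ.modular U V).ge) }
    have hν : ν ∈ C := by
      by_contra hν
      obtain ⟨s, ⟨f, ⟨hf, hsub⟩, rfl⟩, hνs, hsC⟩ :=
        (isTopologicalBasis_of_subbasis (α := SubprobVal X) rfl).exists_subset_of_mem_open
          (show ν ∈ Cᶜ from hν) hcl.isOpen_compl
      obtain ⟨μ, hμ, hμ'⟩ := isIrreducible_iff_sInter.1 hC hf.toFinset
        (fun u hu => by
          obtain ⟨U, r, rfl⟩ := hsub (hf.mem_toFinset.1 hu)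
          exact isOpen_gt U r)
        (fun u hu => by
          have hu' := hf.mem_toFinset.1 hu
          obtain ⟨U, r, rfl⟩ := hsub hu'
          obtain ⟨μ, hμ, h⟩ := hex U r (hνs _ hu')
          exact ⟨μ, hμ, h⟩)
      exact hsC (by simpa using hμ') hμ
    refine ⟨ν, isGenericPoint_iff_specializes.2 fun μ => ⟨fun h => h.mem_closed hcl hν, fun h =>
      specializes_iff.2 (hle μ h)⟩⟩

lemma isOpen_scott_gt (t : ℝ) :
    IsOpen {a : WithScott unitInterval | t < ((WithScott.ofScott a : unitInterval) : ℝ)} := by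
  by_cases h0 : t < 0
  · convert isOpen_univ
    exact Set.eq_univ_of_forall fun a =>
      h0.trans_le (show (0 : ℝ) ≤ ((WithScott.ofScott a : unitInterval) : ℝ) from
        (WithScott.ofScott a : unitInterval).2.1)
  by_cases h1 : 1 < t
  · convert isOpen_empty
    refine Set.eq_empty_of_forall_notMem fun a ha => ?_
    exact absurd (show ((WithScott.ofScott a : unitInterval) : ℝ) ≤ 1 from
      (WithScott.ofScott a : unitInterval).2.2) (not_le.2 (h1.trans ha))
  · have hc : IsClosed (Set.Iic (WithScott.toScott (⟨t, not_lt.1 h0, not_lt.1 h1⟩ :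
      unitInterval))) := isClosed_Iic
    convert hc.isOpen_compl
    ext a
    exact (not_le (a := (WithScott.ofScott a : unitInterval))
      (b := ⟨t, not_lt.1 h0, not_lt.1 h1⟩)).symm

/-- The Choquet integral `∫₀¹ ν(g⁻¹(t,1]) dt` of a map `g : X → [0,1]` that is continuous for the
Scott topology on `[0,1]`. -/
noncomputable def choquet (ν : SubprobVal X) (g : C(X, WithScott unitInterval)) : ℝ :=
  ∫ t in (0 : ℝ)..1,
    (ν ⟨{x | t < ((WithScott.ofScott (g x) : unitInterval) : ℝ)},
      (isOpen_scott_gt t).preimage g.continuous⟩ : ℝ)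

end SubprobVal

/-! ### The functors `Σ ⊣ Ω` between dcpos and d-spaces -/

lemma specialization_withScott (D : Type u) [q : PartialOrder D] :
    Specialization.instPreorder (α := WithScott D) = q.toPreorder := by
  refine Preorder.ext fun x y => ?_
  have h : (WithScott.toScott (α := D) y ⤳ WithScott.toScott (α := D) x) ↔ q.le x y := by
    rw [specializes_iff_mem_closure, IsScott.closure_singleton]
    exact Iff.rfl
  exact h

lemma isDSpace_withScott (D : DCPO.{u}) : IsDSpace (TopCat.of (WithScott D)) := by
  have aux : ∀ p : Preorder D.carrier, p = D.order.toPreorder →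
      (∀ d : Set D, d.Nonempty → DirectedOn p.le d → ∃ a, @IsLUB D p.toLE d a) ∧
      ∀ U : Set D, IsOpen[@Topology.scott D Set.univ D.order.toPreorder] U →
        IsOpen[@Topology.scott D Set.univ p] U := by
    rintro p rfl
    exact ⟨D.directedComplete, fun U h => h⟩
  obtain ⟨h1, h2⟩ := aux _ (specialization_withScott D)
  refine ⟨?_, h1, fun U hU => h2 U ?_⟩
  swap
  · have hU' : IsOpen[Topology.scott (WithScott D) Set.univ] U := by
      rw [← IsScott.topology_eq (WithScott D) Set.univ]
      exact hU
    exact hU'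
  let _ : PartialOrder (WithScott D) := inferInstanceAs (PartialOrder D)
  exact inferInstanceAs (T0Space (WithScott D))

lemma scottContinuous_of_continuous {P X : Type u} [Preorder P] [TopologicalSpace X] {f : P → X}
    (hf : Continuous (fun p : WithScott P => f (WithScott.ofScott p))) :
    ScottContinuous (fun p => Specialization.toEquiv (f p)) := by
  have hmono : Monotone (fun p => Specialization.toEquiv (f p)) := by
    intro p q hpq
    change f q ⤳ f p
    refine Specializes.map (x := WithScott.toScott q) (y := WithScott.toScott p) ?_ hf
    rw [specializes_iff_mem_closure, IsScott.closure_singleton]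
    exact hpq
  intro d hd hdir a ha
  refine ⟨hmono.mem_upperBounds_image ha.1, fun b hb => ?_⟩
  change (Specialization.ofEquiv b) ⤳ f a
  rw [specializes_iff_mem_closure]
  by_contra hcon
  have ho := (isClosed_closure (s := {Specialization.ofEquiv b})).isOpen_compl.preimage hf
  obtain ⟨c, hc, hc'⟩ := ((IsScott.isOpen_iff_isUpperSet_and_dirSupInaccOn
    (D := Set.univ)).1 ho).2 (Set.mem_univ d) hd hdir ha hcon
  exact hc' (specializes_iff_mem_closure.1 (hb ⟨c, hc, rfl⟩))

lemma continuous_withScott {P Q : Type u} [Preorder P] [Preorder Q] {f : P → Q}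
    (hf : ScottContinuous f) :
    Continuous (fun p : WithScott P => WithScott.toScott (f (WithScott.ofScott p))) :=
  (IsScott.scottContinuousOn_iff_continuous (α := WithScott P) (β := WithScott Q)
    (D := Set.univ) (fun _ _ _ => trivial)).1 (scottContinuousOn_univ.2 hf)

lemma continuous_of_scottContinuous {P X : Type u} [Preorder P] [TopologicalSpace X] {f : P → X}
    (hX : ∀ U : Set X, IsOpen U → IsOpen[Topology.scott (Specialization X) Set.univ] U)
    (hf : ScottContinuous (fun p => Specialization.toEquiv (f p))) :
    Continuous (fun p : WithScott P => f (WithScott.ofScott p)) :=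
  continuous_def.2 fun U hU => IsOpen.preimage (continuous_withScott hf) (t := U) (hX U hU)

/-- `Σ` equips a dcpo with its Scott topology. -/
def sigmaFunctor : DCPO.{u} ⥤ DSpace.{u} where
  obj D := ⟨TopCat.of (WithScott D), isDSpace_withScott D⟩
  map {D E} f := ObjectProperty.homMk (TopCat.ofHom
    ⟨fun x => WithScott.toScott (f.toFun (WithScott.ofScott x)),
      continuous_withScott f.scottContinuous⟩)

/-- `Ω` equips a d-space with its specialization order. -/
def omegaFunctor : DSpace.{u} ⥤ DCPO.{u} where
  obj X :=
    { carrier := Specialization X.obj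
      order := @Specialization.instPartialOrder X.obj _ X.property.1
      directedComplete := X.property.2.1 }
  map {X Y} f :=
    { toFun := fun x => Specialization.toEquiv (f.hom.hom (Specialization.ofEquiv x))
      scottContinuous := scottContinuous_of_continuous (P := Specialization X.obj)
        (f := fun x => f.hom.hom (Specialization.ofEquiv x))
        (continuous_def.2 fun U hU => X.property.2.2 _ (hU.preimage f.hom.hom.continuous)) }

/-- The adjunction `Σ ⊣ Ω`; both directions of the bijection between continuous maps `Σ D → X` and
Scott-continuous maps `D → Ω X` leave the underlying function unchanged. -/
def sigmaOmegaAdj : sigmaFunctor.{u} ⊣ omegaFunctor.{u} :=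
  Adjunction.mkOfHomEquiv
    { homEquiv := fun D X =>
        { toFun := fun g =>
            { toFun := fun x => Specialization.toEquiv (g.hom.hom (WithScott.toScott x))
              scottContinuous := scottContinuous_of_continuous (P := D)
                (f := fun x => g.hom.hom (WithScott.toScott x)) g.hom.hom.continuous }
          invFun := fun f => ObjectProperty.homMk (TopCat.ofHom
            ⟨fun x => Specialization.ofEquiv (f.toFun (WithScott.ofScott x)),
              continuous_of_scottContinuous (P := D)
                (X := X.obj)
                (f := fun x => Specialization.ofEquiv (f.toFun x)) X.property.2.2
                f.scottContinuous⟩)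
          left_inv := fun _ => rfl
          right_inv := fun _ => rfl }
      homEquiv_naturality_left_symm := fun _ _ => rfl
      homEquiv_naturality_right := fun _ _ => rfl }

/-! ### The valuation functors `V_K` and `V_{K,≤}` -/

section VK

variable {K : ObjectProperty TopCat.{u}}

/-- The underlying set of `V_K X`: the intersection of all k-subspaces of the weak space of
valuations that contain all simple valuations. As a subtype it carries the relative topology. -/
def VKSet (K : ObjectProperty TopCat.{u}) (X : Type u) [TopologicalSpace X] :
    Set (SubprobVal X) :=
  ⋂₀ {A | {ν | ν.IsSimple} ⊆ A ∧ K (TopCat.of A)}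

variable {X Y : Type u} [TopologicalSpace X] [TopologicalSpace Y]

lemma VKSet_mem (hK : IsKCategory K) : K (TopCat.of (VKSet K X)) :=
  hK.sInter (TopCat.of (SubprobVal X)) SubprobVal.isSober _ fun _ hA => hA.2

lemma simple_mem_VKSet {ν : SubprobVal X} (h : ν.IsSimple) : ν ∈ VKSet K X :=
  fun _ hA => hA.1 h

lemma map_mem_VKSet (hK : IsKCategory K) (f : C(X, Y)) {ν : SubprobVal X} (hν : ν ∈ VKSet K X) :
    SubprobVal.map f ν ∈ VKSet K Y := fun A hA =>
  hν (SubprobVal.map f ⁻¹' A) ⟨fun _ hμ => hA.1 (SubprobVal.IsSimple.map hμ f),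
    hK.preimage (TopCat.of (SubprobVal X)) (TopCat.of (SubprobVal Y)) SubprobVal.isSober
      SubprobVal.isSober ⟨_, SubprobVal.continuous_map f⟩ A hA.2⟩

/-- Evaluation `ν ↦ ν U` on `V_K X`, continuous for the Scott topology on `[0,1]`. -/
def evalVK (U : Opens X) : C(VKSet K X, WithScott unitInterval) where
  toFun ν := WithScott.toScott (ν.1 U)
  continuous_toFun := by
    refine continuous_def.2 fun s hs => ?_
    let _ : TopologicalSpace unitInterval := Topology.scott unitInterval Set.univ
    have : IsScott unitInterval Set.univ := ⟨rfl⟩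
    rcases (IsScott.isOpen_iff_Iic_compl_or_univ (α := unitInterval) s).1 hs with rfl | ⟨r, rfl⟩
    · exact isOpen_univ
    · convert! (SubprobVal.isOpen_gt U r).preimage continuous_subtype_val using 1
      ext ν
      exact not_le (a := ν.1 U) (b := r)

/-- The functor `V_K` on d-spaces, for a K-category `K` consisting of d-spaces. -/
def VK (hK : IsKCategory K) (hKD : K ≤ IsDSpace) : DSpace.{u} ⥤ DSpace.{u} where
  obj X := ⟨TopCat.of (VKSet K X.obj), hKD _ (VKSet_mem hK)⟩
  map {X Y} f := ObjectProperty.homMk (TopCat.ofHom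
    ⟨fun ν => ⟨SubprobVal.map f.hom.hom ν.1, map_mem_VKSet hK _ ν.2⟩,
      ((SubprobVal.continuous_map f.hom.hom).comp continuous_subtype_val).subtype_mk _⟩)

/-- `V_{K,≤} = Ω ∘ V_K ∘ Σ`. -/
def VKle (hK : IsKCategory K) (hKD : K ≤ IsDSpace) : DCPO.{u} ⥤ DCPO.{u} :=
  sigmaFunctor ⋙ VK hK hKD ⋙ omegaFunctor

end VK

/-! ### Monad structures on a given endofunctor -/

/-- The structure of a monad on a fixed endofunctor `F`. -/
structure MonadOn {C : Type*} [Category C] (F : C ⥤ C) where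
  η : 𝟭 C ⟶ F
  μ : F ⋙ F ⟶ F
  assoc : ∀ X, F.map (μ.app X) ≫ μ.app X = μ.app (F.obj X) ≫ μ.app X
  left_unit : ∀ X, η.app (F.obj X) ≫ μ.app X = 𝟙 (F.obj X)
  right_unit : ∀ X, F.map (η.app X) ≫ μ.app X = 𝟙 (F.obj X)

namespace MonadOn

variable {C : Type*} [Category C] {F : C ⥤ C}

/-- The corresponding monad in Mathlib's sense, with underlying endofunctor `F`. -/
def toMonad (T : MonadOn F) : Monad C where
  toFunctor := F
  η := T.η
  μ := T.μ
  assoc := T.assoc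
  left_unit := T.left_unit
  right_unit := T.right_unit

/-- The Kleisli extension `f† = μ ∘ F f`. -/
def ext (T : MonadOn F) {X Y : C} (f : X ⟶ F.obj Y) : F.obj X ⟶ F.obj Y :=
  F.map f ≫ T.μ.app Y

end MonadOn

/-! On all subprobability valuations, integration gives a Kleisli extension `bind f ν (U) = ∫
f(x)(U) dν`. Three things must be shown: it is a valuation depending continuously on `ν`, it obeys
the monad laws, and it preserves `V_K`.

The first two rest on additivity of the integral and on a Fubini-type exchange, and valuations are
only defined on open sets. The integral is therefore compared with Riemann sums of step `1 / N`,
which are finite sums of masses of open superlevel sets. After multiplication by `N`, every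
comparison has an error bounded independently of `N`, so exact equalities follow by the Archimedean
property. The combinatorial core is `sum_innerMass_eq_sum_card`, a consequence of modularity. It
gives `card_mul_layerIntegral_of_average`, hence modularity of `bind` and, through
`layerIntegral_bind`, associativity.

For the third point, the space of valuations is sober, so continuous preimages of k-subspaces are
k-subspaces: a continuous map that sends simple valuations into `V_K Y` sends all of `V_K X` there.
At a simple valuation `bind f` is a subconvex combination of values of `f`, and `V_K Y` is closed
under these combinations by the same principle applied one coordinate at a time.

The monad on dcpos then comes from the composite adjunction. Its endofunctor is `VKle` by
definition, and transposition along `Σ ⊣ Ω` does not change functions, so its formulas are those of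
`V_K` on d-spaces. -/

namespace SubprobVal

/-! ### Masses of open sets and the layer-cake integral -/

section LayerIntegral

variable {X : Type u} [TopologicalSpace X]

/-- The mass that a valuation gives to the interior of a set, as a real number. -/
def innerMass (ν : SubprobVal X) (s : Set X) : ℝ := ν ⟨interior s, isOpen_interior⟩

lemma innerMass_of_isOpen (ν : SubprobVal X) {s : Set X} (hs : IsOpen s) :
    ν.innerMass s = ν ⟨s, hs⟩ := by
  simp only [innerMass, hs.interior_eq]

lemma innerMass_nonneg (ν : SubprobVal X) (s : Set X) : 0 ≤ ν.innerMass s := (ν _).2.1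

lemma innerMass_le_one (ν : SubprobVal X) (s : Set X) : ν.innerMass s ≤ 1 := (ν _).2.2

lemma innerMass_mono (ν : SubprobVal X) {s t : Set X} (h : s ⊆ t) :
    ν.innerMass s ≤ ν.innerMass t :=
  ν.scottContinuous.monotone (show (⟨interior s, isOpen_interior⟩ : Opens X) ≤
    ⟨interior t, isOpen_interior⟩ from interior_mono h)

@[simp]
lemma innerMass_empty (ν : SubprobVal X) : ν.innerMass ∅ = 0 := by
  rw [ν.innerMass_of_isOpen isOpen_empty]
  exact congrArg _ ν.strict

lemma innerMass_union_add_inter (ν : SubprobVal X) {s t : Set X} (hs : IsOpen s) (ht : IsOpen t) :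
    ν.innerMass (s ∪ t) + ν.innerMass (s ∩ t) = ν.innerMass s + ν.innerMass t := by
  rw [ν.innerMass_of_isOpen hs, ν.innerMass_of_isOpen ht, ν.innerMass_of_isOpen (hs.union ht),
    ν.innerMass_of_isOpen (hs.inter ht)]
  exact (ν.modular ⟨s, hs⟩ ⟨t, ht⟩).symm

open Classical in
lemma isOpen_le_card_filter {ι : Type*} (s : Finset ι) {U : ι → Set X} (hU : ∀ i, IsOpen (U i))
    (j : ℕ) : IsOpen {x | j ≤ (s.filter fun i => x ∈ U i).card} := by
  induction s using Finset.induction_on generalizing j with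
  | empty => by_cases hj : j = 0 <;> simp [hj]
  | insert a s ha ih =>
    have : {x | j ≤ ((insert a s).filter fun i => x ∈ U i).card} =
        {x | j ≤ (s.filter fun i => x ∈ U i).card} ∪
          ({x | j ≤ (s.filter fun i => x ∈ U i).card + 1} ∩ U a) := by
      ext x
      by_cases hx : x ∈ U a
      · simp [Finset.filter_insert, hx, ha]; omega
      · simp [Finset.filter_insert, hx]
    rw [this]
    refine (ih j).union (IsOpen.inter ?_ (hU a))
    rcases j with _ | j
    · simp
    · simpa using ih j

open Classical in
/-- A sum of masses of open sets is the sum of the masses of the sets of points that belong to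
at least `j + 1` of them. -/
lemma sum_innerMass_eq_sum_card (ν : SubprobVal X) {ι : Type*} (s : Finset ι) {U : ι → Set X}
    (hU : ∀ i, IsOpen (U i)) {M : ℕ} (hM : s.card ≤ M) :
    ∑ i ∈ s, ν.innerMass (U i) =
      ∑ j ∈ Finset.range M, ν.innerMass {x | j + 1 ≤ (s.filter fun i => x ∈ U i).card} := by
  induction s using Finset.induction_on with
  | empty => simp
  | insert a s ha ih =>
    rw [Finset.card_insert_of_notMem ha] at hM
    set c : X → ℕ := fun x => (s.filter fun i => x ∈ U i).card
    have hc : ∀ j, IsOpen {x | j ≤ c x} := isOpen_le_card_filter s hU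
    -- A point lies in `j + 1` of the enlarged family iff it already lay in `j + 1` of the old sets,
    -- or lay in `j` of them and lies in `U a`. Modularity of this union leaves a difference that
    -- telescopes over `j`.
    have hstep : ∀ j, ν.innerMass {x | j + 1 ≤ ((insert a s).filter fun i => x ∈ U i).card} =
        ν.innerMass {x | j + 1 ≤ c x} + (ν.innerMass ({x | j ≤ c x} ∩ U a) -
          ν.innerMass ({x | j + 1 ≤ c x} ∩ U a)) := by
      intro j
      have h1 : {x | j + 1 ≤ ((insert a s).filter fun i => x ∈ U i).card} =
          {x | j + 1 ≤ c x} ∪ ({x | j ≤ c x} ∩ U a) := by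
        ext x
        by_cases hx : x ∈ U a
        · simp [Finset.filter_insert, hx, ha, c]; omega
        · simp [Finset.filter_insert, hx, c]
      have h2 : {x | j + 1 ≤ c x} ∩ U a = {x | j + 1 ≤ c x} ∩ ({x | j ≤ c x} ∩ U a) := by
        ext x
        simp only [Set.mem_inter_iff, Set.mem_ofPred_eq]
        constructor
        · rintro ⟨h, h'⟩; exact ⟨h, by omega, h'⟩
        · rintro ⟨h, _, h'⟩; exact ⟨h, h'⟩
      have := ν.innerMass_union_add_inter (hc (j + 1)) ((hc j).inter (hU a))
      rw [h1, h2]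
      linarith
    rw [Finset.sum_insert ha, ih (by omega), Finset.sum_congr rfl fun j _ => hstep j,
      Finset.sum_add_distrib,
      Finset.sum_range_sub' (fun j => ν.innerMass ({x | j ≤ c x} ∩ U a))]
    have h0 : {x | 0 ≤ c x} ∩ U a = U a := by simp
    -- The far end of the telescope vanishes because `c` is at most `s.card`, which is strictly
    -- below `M`.
    have h1 : {x | M ≤ c x} ∩ U a = ∅ := by
      refine Set.eq_empty_of_forall_notMem fun x hx => ?_
      have h : M ≤ c x := hx.1
      have h' : c x ≤ s.card := Finset.card_filter_le _ _
      omega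
    rw [h0, h1, innerMass_empty]
    ring

/-- The layer-cake integral of a real function with values in `[0,1]`. -/
noncomputable def layerIntegral (ν : SubprobVal X) (φ : X → ℝ) : ℝ :=
  ∫ t in (0 : ℝ)..1, ν.innerMass {x | t < φ x}

lemma choquet_eq_layerIntegral (ν : SubprobVal X) (g : C(X, WithScott unitInterval)) :
    ν.choquet g = ν.layerIntegral fun x => ((WithScott.ofScott (g x) : unitInterval) : ℝ) := by
  refine intervalIntegral.integral_congr fun t _ => ?_
  exact (ν.innerMass_of_isOpen ((isOpen_scott_gt t).preimage g.continuous)).symm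

lemma antitone_innerMass_gt (ν : SubprobVal X) (φ : X → ℝ) :
    Antitone fun t : ℝ => ν.innerMass {x | t < φ x} :=
  fun _ _ h => ν.innerMass_mono fun _ hx => h.trans_lt hx

lemma layerIntegral_nonneg (ν : SubprobVal X) (φ : X → ℝ) : 0 ≤ ν.layerIntegral φ :=
  intervalIntegral.integral_nonneg zero_le_one fun _ _ => ν.innerMass_nonneg _

lemma layerIntegral_le_one (ν : SubprobVal X) (φ : X → ℝ) : ν.layerIntegral φ ≤ 1 := by
  have := intervalIntegral.integral_mono_on zero_le_one
    (ν.antitone_innerMass_gt φ).intervalIntegrable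
    (intervalIntegrable_const (μ := MeasureTheory.volume) (c := (1 : ℝ)))
    fun t _ => ν.innerMass_le_one {x | t < φ x}
  simpa [layerIntegral] using this

lemma layerIntegral_mono (ν : SubprobVal X) {φ ψ : X → ℝ} (h : ∀ x, φ x ≤ ψ x) :
    ν.layerIntegral φ ≤ ν.layerIntegral ψ :=
  intervalIntegral.integral_mono_on zero_le_one (ν.antitone_innerMass_gt φ).intervalIntegrable
    (ν.antitone_innerMass_gt ψ).intervalIntegrable fun _ _ =>
      ν.innerMass_mono fun x hx => lt_of_lt_of_le hx (h x)

/-! ### Riemann sums and additivity of the integral -/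

/-- The lower Riemann sum with `N` steps, multiplied by `N`. -/
def layerSum (ν : SubprobVal X) (N : ℕ) (φ : X → ℝ) : ℝ :=
  ∑ k ∈ Finset.range N, ν.innerMass {x | (k + 1 : ℝ) < N * φ x}

/-- Rescaling by `N` puts the partition points at the integers; the limit `0 + N` matches the form
of the sum–integral comparison for antitone functions. -/
lemma mul_layerIntegral_eq (ν : SubprobVal X) {N : ℕ} (hN : 0 < N) (φ : X → ℝ) :
    N * ν.layerIntegral φ = ∫ t in (0 : ℝ)..(0 + N), ν.innerMass {x | t < N * φ x} := by
  have hN' : (0 : ℝ) < N := by exact_mod_cast hN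
  have h := intervalIntegral.integral_comp_div (a := 0) (b := (N : ℝ))
    (fun t => ν.innerMass {x | t < φ x}) hN'.ne'
  rw [zero_div, div_self hN'.ne', smul_eq_mul] at h
  rw [layerIntegral, ← h, zero_add]
  refine intervalIntegral.integral_congr fun t _ => ?_
  simp only [div_lt_iff₀' hN']

lemma layerSum_le (ν : SubprobVal X) {N : ℕ} (hN : 0 < N) (φ : X → ℝ) :
    ν.layerSum N φ ≤ N * ν.layerIntegral φ := by
  rw [mul_layerIntegral_eq ν hN]
  have := ((ν.antitone_innerMass_gt fun x => N * φ x).antitoneOn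
    (Set.Icc 0 (0 + (N : ℝ)))).sum_le_integral
  simpa [layerSum] using this

/-- The upper and lower sums differ only in their end terms, and the extra term at threshold `0` is
at most `1`. -/
lemma le_layerSum_add_one (ν : SubprobVal X) {N : ℕ} (hN : 0 < N) (φ : X → ℝ) :
    N * ν.layerIntegral φ ≤ ν.layerSum N φ + 1 := by
  rw [mul_layerIntegral_eq ν hN]
  have h := ((ν.antitone_innerMass_gt fun x => N * φ x).antitoneOn
    (Set.Icc 0 (0 + (N : ℝ)))).integral_le_sum
  have h' := Finset.sum_range_succ (fun k : ℕ => ν.innerMass {x | (k : ℝ) < N * φ x}) N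
  rw [Finset.sum_range_succ'] at h'
  have h0 := ν.innerMass_le_one {x | ((0 : ℕ) : ℝ) < N * φ x}
  have h1 := ν.innerMass_nonneg {x | (N : ℝ) < N * φ x}
  simp only [zero_add, Nat.cast_add, Nat.cast_one] at h h' h0 h1
  simp only [zero_add, layerSum]
  linarith

/-- Replaces passage to the limit: the error `C` does not grow with `N`, so it disappears after
division by `N`. -/
lemma le_of_forall_nat_mul_le_add {a b C : ℝ} (h : ∀ N : ℕ, 0 < N → N * a ≤ N * b + C) :
    a ≤ b := by
  by_contra! hab
  obtain ⟨N, hN⟩ := exists_nat_gt (C / (a - b))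
  have h1 := h (N + 1) N.succ_pos
  rw [div_lt_iff₀ (sub_pos.2 hab)] at hN
  push_cast at h1
  linarith

lemma eq_of_forall_nat_mul_le_add {a b C : ℝ}
    (h : ∀ N : ℕ, 0 < N → N * a ≤ N * b + C ∧ N * b ≤ N * a + C) : a = b :=
  le_antisymm (le_of_forall_nat_mul_le_add fun N hN => (h N hN).1)
    (le_of_forall_nat_mul_le_add fun N hN => (h N hN).2)

/-- The strict inequality, which keeps superlevel sets open, excludes the threshold `a` itself;
truncated subtraction gives `0` when `a ≤ 0`. -/
lemma card_filter_add_one_lt {N : ℕ} {a : ℝ} (ha : a ≤ N) :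
    ((Finset.range N).filter fun k : ℕ => (k + 1 : ℝ) < a).card = ⌈a⌉₊ - 1 := by
  have hc : ⌈a⌉₊ ≤ N := Nat.ceil_le.2 ha
  rw [← Finset.card_range (⌈a⌉₊ - 1)]
  congr 1
  ext k
  have : (k + 1 : ℝ) < a ↔ k + 1 < ⌈a⌉₊ := by rw [Nat.lt_ceil]; push_cast; rfl
  simp only [Finset.mem_filter, Finset.mem_range, this]
  omega

lemma isOpen_lt_mul {φ : X → ℝ} (hφ : LowerSemicontinuous φ) (N : ℕ) (t : ℝ) :
    IsOpen {x | t < N * φ x} := by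
  rcases N.eq_zero_or_pos with rfl | hN
  · simp
  · have hN' : (0 : ℝ) < N := by exact_mod_cast hN
    simpa only [Set.preimage, Set.mem_Ioi, div_lt_iff₀' hN'] using hφ.isOpen_preimage (t / N)

/-- The layer-cake integral of an average is the average of the integrals. -/
lemma card_mul_layerIntegral_of_average (ν : SubprobVal X) {ι : Type*} [Fintype ι]
    {φ : ι → X → ℝ} (hφ : ∀ i, LowerSemicontinuous (φ i)) (h : ∀ i x, φ i x ∈ unitInterval)
    {ψ : X → ℝ} (hψ : ∀ x, Fintype.card ι * ψ x = ∑ i, φ i x) :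
    Fintype.card ι * ν.layerIntegral ψ = ∑ i, ν.layerIntegral (φ i) := by
  classical
  rcases isEmpty_or_nonempty ι with hι | hι
  · simp
  set M := Fintype.card ι with hMdef
  have hM : 0 < M := Fintype.card_pos
  refine eq_of_forall_nat_mul_le_add (C := 2 * M + 1) fun N hN => ?_
  set s : Finset (ι × ℕ) := Finset.univ ×ˢ Finset.range N
  set U : ι × ℕ → Set X := fun p => {x | (p.2 + 1 : ℝ) < N * φ p.1 x}
  have hU : ∀ p, IsOpen (U p) := fun p => isOpen_lt_mul (hφ p.1) N _
  set c : X → ℕ := fun x => (s.filter fun p => x ∈ U p).card with hcdef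
  have hc : ∀ x, c x = ∑ i, (⌈N * φ i x⌉₊ - 1) := by
    intro x
    have : ∀ i, ⌈N * φ i x⌉₊ - 1 =
        ((Finset.range N).filter fun k : ℕ => (k + 1 : ℝ) < N * φ i x).card := fun i =>
      (card_filter_add_one_lt (mul_le_of_le_one_right N.cast_nonneg (h i x).2)).symm
    simp only [this, hcdef, Finset.card_filter, s, Finset.sum_product]
    rfl
  -- All `M * N` superlevel sets are counted together, so the sum of the integrals becomes a sum
  -- over the levels of the single function `c`, a rounding of `M * N * ψ`.
  have hQ : ∑ i, ν.layerSum N (φ i) =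
      ∑ j ∈ Finset.range (M * N), ν.innerMass {x | j + 1 ≤ c x} := by
    rw [← ν.sum_innerMass_eq_sum_card s hU (by simp [s, M]), Finset.sum_product]
    rfl
  have hsum : ∀ x, ((M * N : ℕ) : ℝ) * ψ x = ∑ i, N * φ i x := by
    intro x
    rw [← Finset.mul_sum, ← hψ x]
    push_cast
    ring
  have hlow : ∑ i, ν.layerSum N (φ i) ≤ ν.layerSum (M * N) ψ := by
    rw [hQ]
    refine Finset.sum_le_sum fun j _ => ν.innerMass_mono fun x hx => ?_
    have hx' : j + 1 ≤ c x := hx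
    rw [hc] at hx'
    change (j + 1 : ℝ) < ((M * N : ℕ) : ℝ) * ψ x
    rw [hsum]
    have hle : ∀ i, ((⌈N * φ i x⌉₊ - 1 : ℕ) : ℝ) ≤ N * φ i x ∧
        (⌈N * φ i x⌉₊ - 1 ≠ 0 → ((⌈N * φ i x⌉₊ - 1 : ℕ) : ℝ) < N * φ i x) := by
      intro i
      have h0 : 0 ≤ N * φ i x := mul_nonneg N.cast_nonneg (h i x).1
      have h1 : ⌈N * φ i x⌉₊ - 1 ≠ 0 → ((⌈N * φ i x⌉₊ - 1 : ℕ) : ℝ) < N * φ i x := by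
        intro hne
        rw [← Nat.lt_ceil]
        omega
      refine ⟨?_, h1⟩
      by_cases hne : ⌈N * φ i x⌉₊ - 1 = 0
      · simpa [hne] using h0
      · exact (h1 hne).le
    -- Only a nonzero count lies strictly below `N * φ i x`; one such index makes the summed
    -- inequality strict.
    obtain ⟨i, _, hi⟩ : ∃ i ∈ Finset.univ, ⌈N * φ i x⌉₊ - 1 ≠ 0 :=
      Finset.exists_ne_zero_of_sum_ne_zero (by omega)
    calc (j + 1 : ℝ) ≤ ((∑ i, (⌈N * φ i x⌉₊ - 1) : ℕ) : ℝ) := by exact_mod_cast hx'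
      _ = ∑ i, ((⌈N * φ i x⌉₊ - 1 : ℕ) : ℝ) := by push_cast; rfl
      _ < ∑ i, N * φ i x :=
        Finset.sum_lt_sum (fun i _ => (hle i).1) ⟨i, Finset.mem_univ i, (hle i).2 hi⟩
  -- Each of the `M` summands loses at most `1` by rounding, so levels shift by at most `M`. The
  -- first `M` shifted levels cost at most `1` each and the others are the levels of `c`.
  have hup : ν.layerSum (M * N) ψ ≤ M + ∑ i, ν.layerSum N (φ i) := by
    rw [hQ]
    set G : ℕ → ℝ := fun j => ν.innerMass {x | j + 1 ≤ c x + M} with hG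
    calc ν.layerSum (M * N) ψ ≤ ∑ j ∈ Finset.range (M * N), G j := by
          refine Finset.sum_le_sum fun j _ => ν.innerMass_mono fun x hx => ?_
          have hx' : (j + 1 : ℝ) < ((M * N : ℕ) : ℝ) * ψ x := hx
          rw [hsum] at hx'
          have h2 : ∑ i, N * φ i x ≤ ((c x + M : ℕ) : ℝ) := by
            calc ∑ i, N * φ i x ≤ ∑ i, (((⌈N * φ i x⌉₊ - 1 : ℕ) : ℝ) + 1) := by
                  refine Finset.sum_le_sum fun i _ => (Nat.le_ceil _).trans ?_
                  have : ⌈N * φ i x⌉₊ ≤ (⌈N * φ i x⌉₊ - 1) + 1 := by omega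
                  exact_mod_cast this
              _ = ((c x + M : ℕ) : ℝ) := by
                  rw [hc, Finset.sum_add_distrib]
                  simp [M]
          have h3 := hx'.trans_le h2
          change j + 1 ≤ c x + M
          exact_mod_cast h3.le
      _ ≤ ∑ j ∈ Finset.range (M + M * N), G j :=
          Finset.sum_le_sum_of_subset_of_nonneg (Finset.range_mono (by omega))
            fun _ _ _ => ν.innerMass_nonneg _
      _ = ∑ j ∈ Finset.range M, G j +
            ∑ j ∈ Finset.range (M * N), ν.innerMass {x | j + 1 ≤ c x} := by
          rw [Finset.sum_range_add]
          congr 1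
          refine Finset.sum_congr rfl fun j _ => ?_
          simp only [hG]
          congr 1
          ext x
          simp only [Set.mem_ofPred_eq]
          omega
      _ ≤ M + _ := by
          gcongr
          calc ∑ j ∈ Finset.range M, G j ≤ ∑ j ∈ Finset.range M, (1 : ℝ) :=
                Finset.sum_le_sum fun _ _ => ν.innerMass_le_one _
            _ = M := by simp
  have hMN : 0 < M * N := Nat.mul_pos hM hN
  have e1 := ν.layerSum_le hMN ψ
  have e2 := ν.le_layerSum_add_one hMN ψ
  have e3 : ∑ i, ν.layerSum N (φ i) ≤ N * ∑ i, ν.layerIntegral (φ i) := by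
    rw [Finset.mul_sum]
    exact Finset.sum_le_sum fun i _ => ν.layerSum_le hN _
  have e4 : N * ∑ i, ν.layerIntegral (φ i) ≤ ∑ i, ν.layerSum N (φ i) + M := by
    rw [Finset.mul_sum]
    calc ∑ i, N * ν.layerIntegral (φ i) ≤ ∑ i, (ν.layerSum N (φ i) + 1) :=
          Finset.sum_le_sum fun i _ => ν.le_layerSum_add_one hN _
      _ = _ := by rw [Finset.sum_add_distrib]; simp [M]
  push_cast at e1 e2
  have hM0 : (0 : ℝ) ≤ M := M.cast_nonneg
  rw [← mul_assoc, mul_comm (N : ℝ)]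
  constructor <;> linarith

/-- Both sides are twice the integral of the common half-sum. Halving keeps the values in `[0,1]`,
where the integral up to `1` sees the whole function. -/
lemma layerIntegral_add_layerIntegral (ν : SubprobVal X) {φ₁ φ₂ ψ₁ ψ₂ : X → ℝ}
    (h₁ : LowerSemicontinuous φ₁) (h₂ : LowerSemicontinuous φ₂)
    (h₃ : LowerSemicontinuous ψ₁) (h₄ : LowerSemicontinuous ψ₂)
    (i₁ : ∀ x, φ₁ x ∈ unitInterval) (i₂ : ∀ x, φ₂ x ∈ unitInterval)
    (i₃ : ∀ x, ψ₁ x ∈ unitInterval) (i₄ : ∀ x, ψ₂ x ∈ unitInterval)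
    (h : ∀ x, φ₁ x + φ₂ x = ψ₁ x + ψ₂ x) :
    ν.layerIntegral φ₁ + ν.layerIntegral φ₂ = ν.layerIntegral ψ₁ + ν.layerIntegral ψ₂ := by
  have e₁ := ν.card_mul_layerIntegral_of_average (φ := ![φ₁, φ₂])
    (ψ := fun x => (φ₁ x + φ₂ x) / 2) (by simp [Fin.forall_fin_two, h₁, h₂])
    (by simpa [Fin.forall_fin_two] using ⟨i₁, i₂⟩) (by intro x; simp; ring)
  have e₂ := ν.card_mul_layerIntegral_of_average (φ := ![ψ₁, ψ₂])
    (ψ := fun x => (φ₁ x + φ₂ x) / 2) (by simp [Fin.forall_fin_two, h₃, h₄])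
    (by simpa [Fin.forall_fin_two] using ⟨i₃, i₄⟩) (by intro x; simp [← h]; ring)
  simpa using e₁.symm.trans e₂

/-- Raising a function by at most `1 / N` raises its layer-cake integral by at most `2 / N`. -/
lemma mul_layerIntegral_le_add_two (ν : SubprobVal X) {N : ℕ} (hN : 0 < N) {φ ψ : X → ℝ}
    (h : ∀ x, N * φ x ≤ N * ψ x + 1) :
    N * ν.layerIntegral φ ≤ N * ν.layerIntegral ψ + 2 := by
  have h1 := ν.le_layerSum_add_one hN φ
  have h2 := ν.layerSum_le hN ψ
  -- The permitted increase is one partition step, so it lowers each threshold by one index. One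
  -- unit of the error pays for the new threshold `0`, the other for the Riemann sum of `φ`.
  have h3 : ν.layerSum N φ ≤ ∑ k ∈ Finset.range N, ν.innerMass {x | (k : ℝ) < N * ψ x} :=
    Finset.sum_le_sum fun k _ => ν.innerMass_mono fun x hx => by
      have hx' : (k + 1 : ℝ) < N * φ x := hx
      have := h x
      change (k : ℝ) < N * ψ x
      linarith
  have h' := Finset.sum_range_succ (fun k : ℕ => ν.innerMass {x | (k : ℝ) < N * ψ x}) N
  rw [Finset.sum_range_succ'] at h'
  have h0 := ν.innerMass_le_one {x | ((0 : ℕ) : ℝ) < N * ψ x}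
  have h4 := ν.innerMass_nonneg {x | (N : ℝ) < N * ψ x}
  simp only [layerSum] at *
  push_cast at *
  linarith

lemma layerIntegral_of_sum {ι : Type*} [Fintype ι] {ν : SubprobVal X} {r : ι → ℝ}
    {ξ : ι → SubprobVal X} (h : ∀ U, (ν U : ℝ) = ∑ i, r i * (ξ i U : ℝ)) (φ : X → ℝ) :
    ν.layerIntegral φ = ∑ i, r i * (ξ i).layerIntegral φ := by
  simp only [layerIntegral, ← intervalIntegral.integral_const_mul]
  rw [← intervalIntegral.integral_finsetSum fun i _ =>
    ((ξ i).antitone_innerMass_gt φ).intervalIntegrable.const_mul _]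
  exact intervalIntegral.integral_congr fun t _ => h _

lemma layerIntegral_dirac (x : X) {φ : X → ℝ} (hφ : LowerSemicontinuous φ)
    (h : φ x ∈ unitInterval) : (dirac x).layerIntegral φ = φ x := by
  classical
  refine eq_of_forall_nat_mul_le_add (C := 1) fun N hN => ?_
  have h1 := (dirac x).le_layerSum_add_one hN φ
  have h2 := (dirac x).layerSum_le hN φ
  have h3 : (dirac x).layerSum N φ = ((⌈N * φ x⌉₊ - 1 : ℕ) : ℝ) := by
    rw [← card_filter_add_one_lt (mul_le_of_le_one_right N.cast_nonneg h.2), Finset.card_filter,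
      layerSum]
    push_cast
    refine Finset.sum_congr rfl fun k _ => ?_
    rw [innerMass_of_isOpen _ (isOpen_lt_mul hφ N _)]
    simp only [dirac]
    by_cases hk : (k + 1 : ℝ) < N * φ x
    · rw [if_pos hk, if_pos (show x ∈ (⟨{x | (k + 1 : ℝ) < N * φ x}, _⟩ : Opens X) from hk)]
      rfl
    · rw [if_neg hk, if_neg (show x ∉ (⟨{x | (k + 1 : ℝ) < N * φ x}, _⟩ : Opens X) from hk)]
      rfl
  have h0 : 0 ≤ N * φ x := mul_nonneg N.cast_nonneg h.1
  have h4 : ((⌈N * φ x⌉₊ - 1 : ℕ) : ℝ) ≤ N * φ x := by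
    by_cases hne : ⌈N * φ x⌉₊ - 1 = 0
    · simpa [hne] using h0
    · refine (Nat.lt_ceil.1 ?_).le
      omega
  have h5 : N * φ x ≤ ((⌈N * φ x⌉₊ - 1 : ℕ) : ℝ) + 1 := by
    refine (Nat.le_ceil _).trans ?_
    have : ⌈N * φ x⌉₊ ≤ (⌈N * φ x⌉₊ - 1) + 1 := by omega
    exact_mod_cast this
  constructor <;> linarith

/-- For `0 < t < 1` the superlevel set is exactly `U`; the endpoint `t = 1`, where it is empty, does
not affect the integral. -/
lemma layerIntegral_dirac_apply (ν : SubprobVal X) (U : Opens X) :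
    (ν.layerIntegral fun x => (dirac x U : ℝ)) = ν U := by
  rw [layerIntegral, intervalIntegral.integral_congr_Ioo_of_le (g := fun _ => (ν U : ℝ))
    zero_le_one]
  · simp
  · intro t ht
    have : {x | t < (dirac x U : ℝ)} = U := by
      ext x
      by_cases hx : x ∈ U
      · simp [dirac, hx, ht.2]
      · simp [dirac, hx, ht.1.le]
    simp only [this]
    exact ν.innerMass_of_isOpen U.isOpen

end LayerIntegral

end SubprobVal

namespace SubprobVal

/-! ### Kleisli extension on all valuations -/

section Bind

variable {X Y Z : Type u} [TopologicalSpace X] [TopologicalSpace Y] [TopologicalSpace Z]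

lemma lowerSemicontinuous_apply (U : Opens X) :
    LowerSemicontinuous fun ν : SubprobVal X => (ν U : ℝ) := by
  refine lowerSemicontinuous_iff_isOpen_preimage.2 fun t => ?_
  by_cases h0 : t < 0
  · convert isOpen_univ
    exact Set.eq_univ_of_forall fun ν => h0.trans_le (ν U).2.1
  by_cases h1 : 1 < t
  · convert isOpen_empty
    exact Set.eq_empty_of_forall_notMem fun ν hν => absurd (ν U).2.2 (not_le.2 (h1.trans hν))
  · exact isOpen_gt U ⟨t, not_lt.1 h0, not_lt.1 h1⟩

lemma continuous_of_lowerSemicontinuous {g : Z → SubprobVal X}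
    (h : ∀ U, LowerSemicontinuous fun z => (g z U : ℝ)) : Continuous g := by
  refine continuous_generateFrom_iff.2 ?_
  rintro _ ⟨U, r, rfl⟩
  exact (h U).isOpen_preimage r

lemma exists_lt_layerSum (ν : SubprobVal X) (φ : X → ℝ) {t : ℝ} (h : t < ν.layerIntegral φ) :
    ∃ N : ℕ, 0 < N ∧ N * t < ν.layerSum N φ := by
  by_contra! hcon
  refine absurd h (not_lt.2 (le_of_forall_nat_mul_le_add (C := 1) fun N hN => ?_))
  exact (ν.le_layerSum_add_one hN φ).trans (by linarith [hcon N hN])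

/-- A strict lower bound on the integral is already witnessed by a Riemann sum, a finite sum of
evaluations at open sets. Nothing is required of `φ`, since only interiors of its superlevel sets
are measured. -/
lemma lowerSemicontinuous_layerIntegral {φ : X → ℝ} :
    LowerSemicontinuous fun ν : SubprobVal X => ν.layerIntegral φ := by
  intro ν t ht
  obtain ⟨N, hN, hlt⟩ := ν.exists_lt_layerSum φ ht
  have hN' : (0 : ℝ) < N := by exact_mod_cast hN
  have hlsc : LowerSemicontinuous fun ν : SubprobVal X => ν.layerSum N φ :=
    lowerSemicontinuous_sum fun _ _ => lowerSemicontinuous_apply _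
  filter_upwards [hlsc ν _ hlt] with μ hμ
  exact lt_of_mul_lt_mul_left (hμ.trans_le (μ.layerSum_le hN φ)) hN'.le

lemma tendsto_apply_iSup (ν : SubprobVal X) {ι : Type*} [Preorder ι] [Nonempty ι]
    [IsDirectedOrder ι] {W : ι → Opens X} (hW : Monotone W) :
    Filter.Tendsto (fun i => (ν (W i) : ℝ)) Filter.atTop (𝓝 (ν (⨆ i, W i) : ℝ)) := by
  refine (continuous_subtype_val.tendsto _).comp (tendsto_atTop_isLUB
    (ν.scottContinuous.monotone.comp hW) ?_)
  have := ν.scottContinuous (Set.range_nonempty W) (directedOn_range.2 hW.directed_le)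
    (isLUB_iSup (f := W))
  rwa [← Set.range_comp] at this

/-- Indexing by the directed set itself turns Scott continuity into an eventual inequality, so
limits of finite sums can be used. -/
lemma scottContinuous_of_tendsto {φ : Opens X → unitInterval} (hm : Monotone φ)
    (h : ∀ (d : Set (Opens X)) [Nonempty d] [IsDirectedOrder d] (r : ℝ), r < φ (⨆ V : d, V.1) →
      ∀ᶠ V : d in Filter.atTop, r < φ V.1) : ScottContinuous φ := by
  refine scottContinuous_of hm fun d hd hdir r hr => ?_
  have : Nonempty d := hd.to_subtype
  have : IsDirectedOrder d := hdir.isDirectedOrder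
  rw [sSup_eq_iSup'] at hr
  obtain ⟨V, hV⟩ := (h d r hr).exists
  exact ⟨V.1, V.2, hV⟩

lemma apply_mem (ν : SubprobVal X) (U : Opens X) : (ν U : ℝ) ∈ unitInterval := (ν U).2

lemma lowerSemicontinuous_comp_apply (f : C(X, SubprobVal Y)) (U : Opens Y) :
    LowerSemicontinuous fun x => (f x U : ℝ) :=
  LowerSemicontinuous.comp (f := fun ν : SubprobVal Y => (ν U : ℝ))
    (lowerSemicontinuous_apply U) f.continuous

lemma innerMass_mem (ν : SubprobVal X) (s : Set X) : ν.innerMass s ∈ unitInterval :=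
  ⟨ν.innerMass_nonneg s, ν.innerMass_le_one s⟩

/-- The extension of a continuous family of valuations on `Y`, indexed by `X`, to the valuations
on `X`. -/
noncomputable def bind (f : C(X, SubprobVal Y)) (ν : SubprobVal X) : SubprobVal Y where
  toFun U := ⟨ν.layerIntegral fun x => (f x U : ℝ), ν.layerIntegral_nonneg _,
    ν.layerIntegral_le_one _⟩
  scottContinuous := by
    refine scottContinuous_of_tendsto (fun U V h => ν.layerIntegral_mono fun x =>
      (f x).scottContinuous.monotone h) fun d _ _ r hr => ?_
    obtain ⟨N, hN, hlt⟩ := ν.exists_lt_layerSum _ hr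
    have hN' : (0 : ℝ) < N := by exact_mod_cast hN
    have hopen : ∀ (V : Opens Y) (k : ℕ), IsOpen {x | (k + 1 : ℝ) < N * (f x V : ℝ)} :=
      fun V k => isOpen_lt_mul (lowerSemicontinuous_comp_apply f V) N _
    have hlim : Filter.Tendsto (fun V : d => ν.layerSum N fun x => (f x V.1 : ℝ)) Filter.atTop
        (𝓝 (ν.layerSum N fun x => (f x (⨆ V : d, V.1) : ℝ))) := by
      refine tendsto_finsetSum _ fun k _ => ?_
      have hmono : Monotone fun V : d => (⟨_, hopen V.1 k⟩ : Opens X) := by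
        intro V V' h x hx
        have hx' : (k + 1 : ℝ) < N * (f x V.1 : ℝ) := hx
        have : (f x V.1 : ℝ) ≤ f x V'.1 := (f x).scottContinuous.monotone h
        exact hx'.trans_le (mul_le_mul_of_nonneg_left this hN'.le)
      -- Scott continuity of each `f x` makes the superlevel set of the supremum a directed union,
      -- to which Scott continuity of `ν` then applies.
      have hsup : (⨆ V : d, (⟨_, hopen V.1 k⟩ : Opens X)) = ⟨_, hopen (⨆ V : d, V.1) k⟩ := by
        ext x
        simp only [Opens.coe_iSup, Set.mem_iUnion, Opens.coe_mk, Set.mem_ofPred_eq]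
        have hlim := (f x).tendsto_apply_iSup (W := fun V : d => V.1) fun _ _ h => h
        constructor
        · rintro ⟨V, hV⟩
          have : (f x V.1 : ℝ) ≤ f x (⨆ V : d, V.1) :=
            (f x).scottContinuous.monotone (le_iSup (fun V : d => V.1) V)
          exact hV.trans_le (mul_le_mul_of_nonneg_left this hN'.le)
        · intro hx
          exact ((hlim.const_mul (N : ℝ)).eventually (lt_mem_nhds hx)).exists
      have := ν.tendsto_apply_iSup hmono
      rw [hsup] at this
      simpa only [innerMass_of_isOpen ν (hopen _ _)] using this
    filter_upwards [hlim.eventually (lt_mem_nhds hlt)] with V hV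
    exact lt_of_mul_lt_mul_left (hV.trans_le (ν.layerSum_le hN _)) hN'.le
  strict := by
    ext
    simp [(f _).strict, layerIntegral, intervalIntegral.integral_congr_Ioo_of_le
      (f := fun t : ℝ => ν.innerMass {_x | t < 0}) (g := fun _ => 0) zero_le_one
      (fun t ht => by simp [not_lt.2 ht.1.le])]
  modular U V := ν.layerIntegral_add_layerIntegral (lowerSemicontinuous_comp_apply f _)
    (lowerSemicontinuous_comp_apply f _) (lowerSemicontinuous_comp_apply f _)
    (lowerSemicontinuous_comp_apply f _) (fun x => apply_mem _ _) (fun x => apply_mem _ _)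
    (fun x => apply_mem _ _) (fun x => apply_mem _ _) fun x => (f x).modular U V

lemma bind_apply (f : C(X, SubprobVal Y)) (ν : SubprobVal X) (U : Opens Y) :
    (bind f ν U : ℝ) = ν.layerIntegral fun x => (f x U : ℝ) := rfl

lemma continuous_bind (f : C(X, SubprobVal Y)) : Continuous (bind f) :=
  continuous_of_lowerSemicontinuous fun _ => lowerSemicontinuous_layerIntegral

lemma layerIntegral_map (f : C(X, Y)) (ν : SubprobVal X) {φ : Y → ℝ}
    (hφ : LowerSemicontinuous φ) :
    (map f ν).layerIntegral φ = ν.layerIntegral fun x => φ (f x) := by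
  refine intervalIntegral.integral_congr fun t _ => ?_
  have h : IsOpen {y | t < φ y} := hφ.isOpen_preimage t
  exact (innerMass_of_isOpen _ h).trans (ν.innerMass_of_isOpen (h.preimage f.continuous)).symm

lemma bind_map (g : C(X, Y)) (f : C(Y, SubprobVal Z)) (ν : SubprobVal X) :
    bind f (map g ν) = bind (f.comp g) ν := by
  ext U
  exact layerIntegral_map g ν (lowerSemicontinuous_comp_apply f U)

lemma bind_dirac (f : C(X, SubprobVal Y)) (x : X) : bind f (dirac x) = f x := by
  ext U
  exact layerIntegral_dirac x (lowerSemicontinuous_comp_apply f U) (apply_mem _ _)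

lemma bind_dirac_right {f : C(X, SubprobVal X)} (hf : ∀ x, f x = dirac x) (ν : SubprobVal X) :
    bind f ν = ν := by
  ext U
  simp only [bind_apply, hf]
  exact layerIntegral_dirac_apply ν U

/-- Integration against `bind f ν` is iterated integration. -/
lemma layerIntegral_bind (f : C(X, SubprobVal Y)) (ν : SubprobVal X) (φ : Y → ℝ) :
    (bind f ν).layerIntegral φ = ν.layerIntegral fun x => (f x).layerIntegral φ := by
  refine eq_of_forall_nat_mul_le_add (C := 3) fun N hN => ?_
  have hN' : (0 : ℝ) < N := by exact_mod_cast hN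
  -- `ψ` is an average of `N` evaluations, so its integral is exactly the Riemann sum for `bind f
  -- ν`; it is also within `1 / N` of the inner integral. The errors `1` and `2` give the constant
  -- `3`.
  set ψ : X → ℝ := fun x => (f x).layerSum N φ / N
  have hψ : ∀ x, N * ψ x = (f x).layerSum N φ := fun x => mul_div_cancel₀ _ hN'.ne'
  have h1 : N * ν.layerIntegral ψ = (bind f ν).layerSum N φ := by
    have := ν.card_mul_layerIntegral_of_average (ι := Fin N)
      (φ := fun k x => (f x).innerMass {y | ((k : ℕ) + 1 : ℝ) < N * φ y}) (ψ := ψ)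
      (fun k => lowerSemicontinuous_comp_apply f _) (fun k x => innerMass_mem _ _)
      (fun x => by rw [Fintype.card_fin, hψ, layerSum, Finset.sum_range])
    rw [Fintype.card_fin] at this
    rw [this, layerSum, Finset.sum_range]
    rfl
  have h2 := (bind f ν).layerSum_le hN φ
  have h3 := (bind f ν).le_layerSum_add_one hN φ
  have h4 := ν.mul_layerIntegral_le_add_two hN (φ := ψ)
    (ψ := fun x => (f x).layerIntegral φ) fun x => by
      rw [hψ]; linarith [(f x).layerSum_le hN φ]
  have h5 := ν.mul_layerIntegral_le_add_two hN (ψ := ψ)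
    (φ := fun x => (f x).layerIntegral φ) fun x => by
      rw [hψ]; exact (f x).le_layerSum_add_one hN φ
  constructor <;> linarith

lemma bind_bind (f : C(X, SubprobVal Y)) (g : C(Y, SubprobVal Z)) (ν : SubprobVal X) :
    bind g (bind f ν) = bind ⟨fun x => bind g (f x), (continuous_bind g).comp f.continuous⟩ ν := by
  ext U
  exact layerIntegral_bind f ν _

/-! ### Subconvex combinations and simple valuations -/

/-- Subconvex combinations of valuations. -/
noncomputable def subconvex {ι : Type*} [Fintype ι] (r : ι → ℝ) (hr : ∀ i, 0 ≤ r i)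
    (hr1 : ∑ i, r i ≤ 1) (ξ : ι → SubprobVal X) : SubprobVal X where
  toFun U := ⟨∑ i, r i * (ξ i U : ℝ),
    Finset.sum_nonneg fun i _ => mul_nonneg (hr i) (apply_mem _ _).1,
    (Finset.sum_le_sum fun i _ => mul_le_of_le_one_right (hr i) (apply_mem _ _).2).trans hr1⟩
  scottContinuous := by
    refine scottContinuous_of_tendsto (fun U V h => Subtype.coe_le_coe.1 <| Finset.sum_le_sum
      fun i _ => mul_le_mul_of_nonneg_left
        (Subtype.coe_le_coe.2 ((ξ i).scottContinuous.monotone h)) (hr i))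
      fun d _ _ t ht => ?_
    exact (tendsto_finsetSum Finset.univ fun i _ => ((ξ i).tendsto_apply_iSup
      (W := fun V : d => V.1) fun _ _ h => h).const_mul (r i)).eventually (lt_mem_nhds ht)
  strict := by
    ext
    simp [(ξ _).strict]
  modular U V := by
    simp only [← Finset.sum_add_distrib, ← mul_add]
    exact Finset.sum_congr rfl fun i _ => congrArg _ ((ξ i).modular U V)

lemma subconvex_apply {ι : Type*} [Fintype ι] (r : ι → ℝ) (hr : ∀ i, 0 ≤ r i)
    (hr1 : ∑ i, r i ≤ 1) (ξ : ι → SubprobVal X) (U : Opens X) :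
    (subconvex r hr hr1 ξ U : ℝ) = ∑ i, r i * (ξ i U : ℝ) := rfl

lemma continuous_subconvex {ι : Type*} [Fintype ι] (r : ι → ℝ) (hr : ∀ i, 0 ≤ r i)
    (hr1 : ∑ i, r i ≤ 1) {g : ι → Z → SubprobVal X} (hg : ∀ i, Continuous (g i)) :
    Continuous fun z => subconvex r hr hr1 fun i => g i z := by
  refine continuous_of_lowerSemicontinuous fun U => ?_
  simp only [subconvex_apply]
  refine lowerSemicontinuous_sum fun i _ => ?_
  exact (continuous_const_mul (r i)).comp_lowerSemicontinuous
    (LowerSemicontinuous.comp (f := fun ν : SubprobVal X => (ν U : ℝ))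
      (lowerSemicontinuous_apply U) (hg i))
    fun _ _ h => mul_le_mul_of_nonneg_left h (hr i)

/-- The integral is linear in the valuation, and `bind f` takes the Dirac valuation at `x` to `f x`.
-/
lemma bind_simple (f : C(X, SubprobVal Y)) {ν : SubprobVal X} {ι : Type*} [Fintype ι]
    (r : ι → ℝ) (hr : ∀ i, 0 ≤ r i) (hr1 : ∑ i, r i ≤ 1) (x : ι → X)
    (h : ∀ U, (ν U : ℝ) = ∑ i, r i * (dirac (x i) U : ℝ)) :
    bind f ν = subconvex r hr hr1 fun i => f (x i) := by
  ext U
  rw [bind_apply, layerIntegral_of_sum h, subconvex_apply]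
  refine Finset.sum_congr rfl fun i _ => ?_
  rw [← bind_apply, bind_dirac]

/-- Simple valuations may be indexed by any finite type, and zero weights are harmless. -/
lemma isSimple_of_fintype {ν : SubprobVal X} {ι : Type*} [Fintype ι] {r : ι → ℝ} {x : ι → X}
    (hr : ∀ i, 0 ≤ r i) (hr1 : ∑ i, r i ≤ 1)
    (h : ∀ U, (ν U : ℝ) = ∑ i, r i * (dirac (x i) U : ℝ)) : ν.IsSimple := by
  classical
  set s : Finset ι := Finset.univ.filter fun i => r i ≠ 0 with hs
  have key : ∀ a : ι → ℝ, ∑ k : Fin s.card, r (s.equivFin.symm k).1 * a (s.equivFin.symm k).1 =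
      ∑ i, r i * a i := by
    intro a
    rw [Equiv.sum_comp s.equivFin.symm fun i : s => r i.1 * a i.1,
      Finset.sum_coe_sort s fun i => r i * a i, hs, Finset.sum_filter]
    refine Finset.sum_congr rfl fun i _ => ?_
    by_cases hi : r i = 0 <;> simp [hi]
  refine ⟨s.card, fun k => r (s.equivFin.symm k).1, fun k => x (s.equivFin.symm k).1,
    fun k => lt_of_le_of_ne (hr _)
      (Finset.mem_filter.1 (s.equivFin.symm k).2).2.symm, ?_, fun U => ?_⟩
  · simpa using (key fun _ => 1).trans_le (by simpa using hr1)
  · rw [h U, key fun i => (dirac (x i) U : ℝ)]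

lemma isSimple_subconvex {ι : Type*} [Fintype ι] {r : ι → ℝ} (hr : ∀ i, 0 ≤ r i)
    (hr1 : ∑ i, r i ≤ 1) {ξ : ι → SubprobVal X} (hξ : ∀ i, (ξ i).IsSimple) :
    (subconvex r hr hr1 ξ).IsSimple := by
  choose n a x ha ha1 h using hξ
  refine isSimple_of_fintype (ι := (i : ι) × Fin (n i)) (r := fun p => r p.1 * a p.1 p.2)
    (x := fun p => x p.1 p.2) (fun p => mul_nonneg (hr _) (ha _ _).le) ?_ fun U => ?_
  · rw [Fintype.sum_sigma]
    simp only [← Finset.mul_sum]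
    exact (Finset.sum_le_sum fun i _ => mul_le_of_le_one_right (hr i) (ha1 i)).trans hr1
  · rw [Fintype.sum_sigma, subconvex_apply]
    simp only [h, Finset.mul_sum, mul_assoc]

end Bind

end SubprobVal

/-! ### Closure properties of `V_K` -/

section VKSetClosure

variable {K : ObjectProperty TopCat.{u}} {X Y : Type u} [TopologicalSpace X] [TopologicalSpace Y]

/-- To map `V_K X` into `V_K Y` it is enough that a continuous map of the spaces of valuations
sends simple valuations into `V_K Y`. -/
lemma apply_mem_VKSet (hK : IsKCategory K) {g : SubprobVal X → SubprobVal Y} (hg : Continuous g)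
    (h : ∀ ν : SubprobVal X, ν.IsSimple → g ν ∈ VKSet K Y) {ν : SubprobVal X}
    (hν : ν ∈ VKSet K X) : g ν ∈ VKSet K Y := fun A hA =>
  hν (g ⁻¹' A) ⟨fun μ hμ => h μ hμ A hA,
    hK.preimage (TopCat.of (SubprobVal X)) (TopCat.of (SubprobVal Y)) SubprobVal.isSober
      SubprobVal.isSober ⟨g, hg⟩ A hA.2⟩

lemma subconvex_mem_VKSet (hK : IsKCategory K) {ι : Type*} [Fintype ι] {r : ι → ℝ}
    (hr : ∀ i, 0 ≤ r i) (hr1 : ∑ i, r i ≤ 1) {ξ : ι → SubprobVal X} (hξ : ∀ i, ξ i ∈ VKSet K X) :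
    SubprobVal.subconvex r hr hr1 ξ ∈ VKSet K X := by
  classical
  -- Here `s` collects the coordinates not required to be simple. To enlarge it by `a`, the other
  -- coordinates are frozen: the combination is continuous in coordinate `a`, and simple values
  -- there are covered by induction.
  suffices H : ∀ (s : Finset ι) (ξ : ι → SubprobVal X), (∀ i ∈ s, ξ i ∈ VKSet K X) →
      (∀ i ∉ s, (ξ i).IsSimple) → SubprobVal.subconvex r hr hr1 ξ ∈ VKSet K X from
    H Finset.univ ξ (fun i _ => hξ i) (by simp)
  intro s
  induction s using Finset.induction_on with
  | empty =>
    exact fun ξ _ h => simple_mem_VKSet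
      (SubprobVal.isSimple_subconvex hr hr1 (by simpa using h))
  | insert a s ha ih =>
    intro ξ h1 h2
    have hcont : Continuous fun μ : SubprobVal X =>
        SubprobVal.subconvex r hr hr1 (Function.update ξ a μ) := by
      refine SubprobVal.continuous_subconvex r hr hr1
        (g := fun i μ => Function.update ξ a μ i) fun i => ?_
      by_cases hi : i = a
      · subst hi; simpa using continuous_id'
      · simpa [hi] using continuous_const
    have := apply_mem_VKSet hK hcont (fun μ hμ => ih _ (fun i hi => ?_) fun i hi => ?_)
      (h1 a (Finset.mem_insert_self a s))
    · simpa using this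
    · rw [Function.update_of_ne (by rintro rfl; exact ha hi)]
      exact h1 i (Finset.mem_insert_of_mem hi)
    · by_cases hia : i = a
      · subst hia; simpa using hμ
      · rw [Function.update_of_ne hia]
        exact h2 i (by simp [hia, hi])

/-- It suffices to treat simple `ν`, where `bind f ν` is a subconvex combination of points of `V_K
Y`. -/
lemma bind_mem_VKSet (hK : IsKCategory K) {f : C(X, SubprobVal Y)} (hf : ∀ x, f x ∈ VKSet K Y)
    {ν : SubprobVal X} (hν : ν ∈ VKSet K X) : SubprobVal.bind f ν ∈ VKSet K Y := by
  refine apply_mem_VKSet hK (SubprobVal.continuous_bind f) ?_ hν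
  rintro μ ⟨n, r, x, hr, hr1, h⟩
  rw [SubprobVal.bind_simple f r (fun i => (hr i).le) hr1 x h]
  exact subconvex_mem_VKSet hK _ _ fun i => hf _

end VKSetClosure

/-! ### The monads on d-spaces and on dcpos -/

section ValuationMonad

variable {K : ObjectProperty TopCat.{u}}

/-- The inclusion of `V_K X` into the space of all valuations. -/
def inclVK (K : ObjectProperty TopCat.{u}) (X : Type u) [TopologicalSpace X] :
    C(VKSet K X, SubprobVal X) := ⟨Subtype.val, continuous_subtype_val⟩

lemma SubprobVal.choquet_evalVK {X Y : Type u} [TopologicalSpace X] [TopologicalSpace Y]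
    (ν : SubprobVal X) (f : C(X, VKSet K Y)) (U : Opens Y) :
    ν.choquet ((evalVK U).comp f) = ν.layerIntegral fun x => ((f x).1 U : ℝ) :=
  ν.choquet_eq_layerIntegral _

lemma SubprobVal.continuous_dirac {X : Type u} [TopologicalSpace X] :
    Continuous (SubprobVal.dirac (X := X)) := by
  refine continuous_generateFrom_iff.2 ?_
  rintro _ ⟨U, r, rfl⟩
  by_cases hr : r < 1
  · convert U.isOpen
    ext x
    by_cases hx : x ∈ U
    · simp [SubprobVal.dirac, hx, hr]
    · simp [SubprobVal.dirac, hx]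
  · convert isOpen_empty
    refine Set.eq_empty_of_forall_notMem fun x hx =>
      hr (lt_of_lt_of_le hx (SubprobVal.apply_mem _ _).2)

/-- The monad structure on `V_K`. -/
noncomputable def valuationMonad (hK : IsKCategory K) (hKD : K ≤ IsDSpace) :
    MonadOn (VK hK hKD) where
  η :=
    { app := fun X => ObjectProperty.homMk (TopCat.ofHom
        ⟨fun x => ⟨SubprobVal.dirac x, simple_mem_VKSet (SubprobVal.isSimple_dirac x)⟩,
          SubprobVal.continuous_dirac.subtype_mk _⟩)
      naturality := fun _ _ _ => rfl }
  μ :=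
    { app := fun X => ObjectProperty.homMk (TopCat.ofHom
        ⟨fun ν : VKSet K (VKSet K X.obj) => (⟨SubprobVal.bind (inclVK K X.obj) ν.1,
            bind_mem_VKSet hK (fun ξ => ξ.2) ν.2⟩ : VKSet K X.obj),
          ((SubprobVal.continuous_bind _).comp continuous_subtype_val).subtype_mk _⟩)
      naturality := fun X Y f => by
        refine ObjectProperty.hom_ext _ (TopCat.hom_ext (ContinuousMap.ext fun ν =>
          Subtype.ext ?_))
        change VKSet K (VKSet K X.obj) at ν
        exact SubprobVal.bind_map ((VK hK hKD).map f).hom.hom (inclVK K Y.obj) ν.1 }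
  assoc X := by
    refine ObjectProperty.hom_ext _ (TopCat.hom_ext (ContinuousMap.ext fun ν => Subtype.ext ?_))
    change VKSet K (VKSet K (VKSet K X.obj)) at ν
    -- Multiplication is `bind` along the inclusion. Absorbing the image valuation into the
    -- integrand turns the left side into the iterated integral of `bind_bind`.
    refine (SubprobVal.bind_map ⟨fun ξ : VKSet K (VKSet K X.obj) =>
        (⟨SubprobVal.bind (inclVK K X.obj) ξ.1, bind_mem_VKSet hK (fun ξ => ξ.2) ξ.2⟩ :
          VKSet K X.obj),
        ((SubprobVal.continuous_bind _).comp continuous_subtype_val).subtype_mk _⟩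
      (inclVK K X.obj) ν.1).trans ?_
    exact (SubprobVal.bind_bind (inclVK K (VKSet K X.obj)) (inclVK K X.obj) ν.1).symm
  left_unit X := by
    refine ObjectProperty.hom_ext _ (TopCat.hom_ext (ContinuousMap.ext fun ν => Subtype.ext ?_))
    exact SubprobVal.bind_dirac (inclVK K X.obj) ν
  right_unit X := by
    refine ObjectProperty.hom_ext _ (TopCat.hom_ext (ContinuousMap.ext fun ν => Subtype.ext ?_))
    change VKSet K X.obj at ν
    refine (SubprobVal.bind_map ⟨fun x : X.obj => (⟨SubprobVal.dirac x,
        simple_mem_VKSet (SubprobVal.isSimple_dirac x)⟩ : VKSet K X.obj),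
        SubprobVal.continuous_dirac.subtype_mk _⟩ (inclVK K X.obj) ν.1).trans ?_
    exact SubprobVal.bind_dirac_right (fun _ => rfl) ν.1

lemma valuationMonad_ext_apply (hK : IsKCategory K) (hKD : K ≤ IsDSpace) (X Y : DSpace.{u})
    (f : X ⟶ (VK hK hKD).obj Y) (ν : VKSet K X.obj) (U : Opens Y.obj) :
    (((((valuationMonad hK hKD).ext f).hom.hom ν : VKSet K Y.obj)).1 U : ℝ) =
      ν.1.choquet ((evalVK U).comp f.hom.hom) := by
  refine Eq.trans ?_ (SubprobVal.choquet_evalVK ν.1 f.hom.hom U).symm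
  exact congrArg (fun ξ : SubprobVal Y.obj => (ξ U : ℝ))
    (SubprobVal.bind_map f.hom.hom (inclVK K Y.obj) ν.1)

/-- The monad structure on `V_{K,≤}` induced by the composite adjunction. -/
noncomputable def valuationMonadLE (hK : IsKCategory K) (hKD : K ≤ IsDSpace) :
    MonadOn (VKle hK hKD) where
  η := (sigmaOmegaAdj.comp (valuationMonad hK hKD).toMonad.adj).toMonad.η
  μ := (sigmaOmegaAdj.comp (valuationMonad hK hKD).toMonad.adj).toMonad.μ
  assoc := (sigmaOmegaAdj.comp (valuationMonad hK hKD).toMonad.adj).toMonad.assoc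
  left_unit := (sigmaOmegaAdj.comp (valuationMonad hK hKD).toMonad.adj).toMonad.left_unit
  right_unit := (sigmaOmegaAdj.comp (valuationMonad hK hKD).toMonad.adj).toMonad.right_unit

end ValuationMonad

theorem mainTheorem4 (K : ObjectProperty TopCat.{u}) (hK : IsKCategory K) (hKD : K ≤ IsDSpace) :
    ∃ (V : MonadOn (VK hK hKD)) (T : MonadOn (VKle hK hKD)),
      -- `V` is the valuation monad on d-spaces:
      (∀ (X : DSpace.{u}) (x : X.obj),
        ((V.η.app X).hom.hom x : VKSet K X.obj).1 = SubprobVal.dirac x) ∧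
      (∀ (X Y : DSpace.{u}) (f : X ⟶ (VK hK hKD).obj Y) (ν : VKSet K X.obj) (U : Opens Y.obj),
        (((V.ext f).hom.hom ν : VKSet K Y.obj).1 U : ℝ) =
          ν.1.choquet ((evalVK U).comp f.hom.hom)) ∧
      -- the monad `T` on dcpos is induced by the composite of `Σ ⊣ Ω` with the
      -- Eilenberg-Moore adjunction of `V`:
      T.toMonad = (sigmaOmegaAdj.comp V.toMonad.adj).toMonad ∧
      -- its unit and its Kleisli extension:
      (∀ (D : DCPO.{u}) (x : D),
        (Specialization.ofEquiv ((T.η.app D).toFun x) : VKSet K (WithScott D)).1 =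
          SubprobVal.dirac (WithScott.toScott x)) ∧
      (∀ (D E : DCPO.{u}) (f : D ⟶ (VKle hK hKD).obj E) (ν : VKSet K (WithScott D))
        (U : Opens (WithScott E)),
        ((Specialization.ofEquiv ((T.ext f).toFun (Specialization.toEquiv ν)) :
          VKSet K (WithScott E)).1 U : ℝ) =
          ν.1.choquet ((evalVK U).comp
            ((sigmaOmegaAdj.homEquiv D ((VK hK hKD).obj (sigmaFunctor.obj E))).symm f).hom.hom)) := by
  refine ⟨valuationMonad hK hKD, valuationMonadLE hK hKD, fun _ _ => rfl,
    valuationMonad_ext_apply hK hKD, rfl, fun D x => ?_, fun D E f ν U => ?_⟩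
  · rfl
  -- The extension of `f` on dcpos has, by definition, the same underlying function as the extension
  -- of its transpose on d-spaces.
  · exact valuationMonad_ext_apply hK hKD (sigmaFunctor.obj D) (sigmaFunctor.obj E)
      ((sigmaOmegaAdj.homEquiv D ((VK hK hKD).obj (sigmaFunctor.obj E))).symm f) ν U
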